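/- Let $k\ge 2$, let $\mathcal P$ be a probability distribution on $\{1,\dots,k\}$ with masses $p_1>p_2\ge p_3\ge\dots\ge p_k$, let $X_1,X_2,\dots$ be i.i.d. samples from $\mathcal P$, and let $\delta>0$. For $t\ge1$ and $i\in\{1,\dots,k\}$ put $Z^i_t=1$ if $X_t=i$ and $Z^i_t=0$ otherwise, $\hat p_i^t=\frac1t\sum_{j=1}^t Z^i_j$, and, for $t\ge 2$, $$V_t(Z^i)=\frac1{t(t-1)}\sum_{1\le r<s\le t}(Z^i_r-Z^i_s)^2,\qquad \beta_i^t=\sqrt{\frac{2V_t(Z^i)\log(4kt^2/\delta)}{t}}+\frac{7\log(4kt^2/\delta)}{3(t-1)},$$ with the convention $\beta_i^1=+\infty$. Consider the sequential algorithm whose $t$-th query reveals $X_t$ ($t=1,2,\dots$) and which, after the $t$-th query, stops and outputs $i$ if there is an $i\in\{1,\dots,k\}$ with $\hat p_i^t-\beta_i^t>\hat p_j^t+\beta_j^t$ for all $j\ne i$, and otherwise makes query $t+1$. Then, with probability at least $1-\delta$, the algorithm stops and the number $Q$ of queries it has made before stopping satisfies $$Q\le\frac{592}{3}\,\frac{p_1}{(p_1-p_2)^2}\,\log\left(\frac{592}{3}\sqrt{\frac{k}{\delta}}\,\frac{p_1}{(p_1-p_2)^2}\right).$$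 -/

import Mathlib

open MeasureTheory ProbabilityTheory

noncomputable section

namespace ModeEstimation

/-- An action of a sequential mode-estimation algorithm with individual-label queries: query the
next sample, or stop and output an estimate of the mode. -/
inductive Action (k : ℕ) where
  | query : Action k
  | output (m : Fin k) : Action k

/-- A sequential algorithm: the action `A_t` taken after `t` samples have been revealed, as a
function of these `t` observations. -/
abbrev SequentialAlgorithm (k : ℕ) := (t : ℕ) → (Fin t → Fin k) → Action k

/-- The number of queries that the algorithm `A` makes on the sample stream `x` before it stops,
that is `inf {t ≥ 1 : A_t = output ·}`; it is `⊤` if `A` never stops. The stream is indexed from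
`0`: the `t`-th query reveals `x (t - 1)`. -/
def SequentialAlgorithm.numQueries {k : ℕ} (A : SequentialAlgorithm k) (x : ℕ → Fin k) : ℕ∞ :=
  ⨅ (t : ℕ) (_ : 1 ≤ t ∧ ∃ m : Fin k, A t (fun s : Fin t => x s) = Action.output m), (t : ℕ∞)

/-- The indicators `Z^i_s = 1{x_s = i}`. -/
def indicatorSeq {k t : ℕ} (x : Fin t → Fin k) (i : Fin k) (s : Fin t) : ℝ :=
  if x s = i then 1 else 0

/-- The empirical estimate of the probability of `i`. -/
def empiricalProb {k t : ℕ} (x : Fin t → Fin k) (i : Fin k) : ℝ :=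
  (∑ s, indicatorSeq x i s) / t

/-- The sample variance `V_t(z) = 1/(t(t-1)) ∑_{p < q} (z_p - z_q)²`. -/
def sampleVariance {t : ℕ} (z : Fin t → ℝ) : ℝ :=
  1 / ((t : ℝ) * ((t : ℝ) - 1)) *
    ∑ pq : Fin t × Fin t with pq.1 < pq.2, (z pq.1 - z pq.2) ^ 2

/-- The empirical-Bernstein confidence width `β_i^t`, meaningful for `t ≥ 2`. -/
def confidenceWidth {k t : ℕ} (δ : ℝ) (x : Fin t → Fin k) (i : Fin k) : ℝ :=
  Real.sqrt (2 * sampleVariance (indicatorSeq x i) * Real.log (4 * k * (t : ℝ) ^ 2 / δ) / t)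
    + 7 * Real.log (4 * k * (t : ℝ) ^ 2 / δ) / (3 * ((t : ℝ) - 1))

/-- The lower confidence bound of `i` exceeds the upper confidence bounds of all other elements.
For `t = 1` the width is `+∞` (its denominator `t - 1` vanishes), so nothing is separated; this is
the condition `2 ≤ t`. -/
def Separated {k t : ℕ} (δ : ℝ) (x : Fin t → Fin k) (i : Fin k) : Prop :=
  2 ≤ t ∧ ∀ j, j ≠ i →
    empiricalProb x i - confidenceWidth δ x i > empiricalProb x j + confidenceWidth δ x j

open Classical in
/-- The mode-estimation algorithm: stop and output `i` as soon as the lower confidence bound of `i`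
exceeds the upper confidence bounds of all other elements, otherwise query the next sample. -/
def modeAlgorithm (k : ℕ) (δ : ℝ) : SequentialAlgorithm k := fun _ x =>
  if h : ∃ i, Separated δ x i then Action.output h.choose else Action.query

end ModeEstimation

end

namespace ModeEstimation

/-! Only the stopping time is bounded, not the correctness of the output, so one deterministic time
suffices: `t`, the integer part of the claimed bound. Write `D = p₁ - p₂`. By Chernoff and a union
bound, outside an event of probability at most `δ`, at time `t` no frequency exceeds its mean by `D
/ 4` and that of the mode does not fall `D / 4` short. Then `separated_of_accurate` applies: the
frequencies are `D / 2` apart, and the widths, controlled deterministically by the frequencies, add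
up to less. Hence the algorithm has stopped by time `t`. `log_factor_le` shows that `t` is large
enough even though the logarithm in the widths depends on `t`. -/

/-! ### Deterministic bounds on the widths, and separation. -/

lemma indicatorSeq_nonneg {k t : ℕ} (x : Fin t → Fin k) (i : Fin k) (s : Fin t) :
    0 ≤ indicatorSeq x i s := by
  unfold indicatorSeq; split_ifs <;> norm_num

lemma sq_indicatorSeq_sub_le {k t : ℕ} (x : Fin t → Fin k) (i : Fin k) (r s : Fin t) :
    (indicatorSeq x i r - indicatorSeq x i s) ^ 2 ≤ indicatorSeq x i r + indicatorSeq x i s := by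
  unfold indicatorSeq; split_ifs <;> norm_num

lemma empiricalProb_nonneg {k t : ℕ} (x : Fin t → Fin k) (i : Fin k) :
    0 ≤ empiricalProb x i :=
  div_nonneg (Finset.sum_nonneg fun s _ => indicatorSeq_nonneg x i s) (Nat.cast_nonneg t)

/-- Twice the sum over pairs `r < s` of the squared differences is at most the sum over all
pairs. -/
lemma two_mul_sum_sq_sub_lt_le {t : ℕ} (z : Fin t → ℝ) :
    2 * ∑ pq : Fin t × Fin t with pq.1 < pq.2, (z pq.1 - z pq.2) ^ 2 ≤
      ∑ pq : Fin t × Fin t, (z pq.1 - z pq.2) ^ 2 := by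
  have hswap : ∑ pq : Fin t × Fin t with pq.1 < pq.2, (z pq.1 - z pq.2) ^ 2 =
      ∑ pq : Fin t × Fin t with pq.2 < pq.1, (z pq.1 - z pq.2) ^ 2 := by
    refine Finset.sum_nbij' Prod.swap Prod.swap ?_ ?_ ?_ ?_ ?_ <;> simp
    intros; ring
  rw [two_mul]
  nth_rewrite 2 [hswap]
  rw [← Finset.sum_union]
  · exact Finset.sum_le_sum_of_subset_of_nonneg (Finset.subset_univ _) fun _ _ _ => sq_nonneg _
  · rw [Finset.disjoint_filter]
    intro pq _ h
    exact h.not_gt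

/-- For 0-1 values, `(a - b)² ≤ a + b`. A variance of the order of the mean is what yields `p₁ / D²`
rather than `1 / D²`. -/
lemma sampleVariance_indicatorSeq_le {k t : ℕ} (ht : 2 ≤ t) (x : Fin t → Fin k) (i : Fin k) :
    sampleVariance (indicatorSeq x i) ≤ t * empiricalProb x i / (t - 1) := by
  have ht' : (2 : ℝ) ≤ t := by exact_mod_cast ht
  have h1 : ∑ pq : Fin t × Fin t, (indicatorSeq x i pq.1 - indicatorSeq x i pq.2) ^ 2 ≤
      2 * (t * ∑ s, indicatorSeq x i s) := by
    refine (Finset.sum_le_sum fun pq _ => sq_indicatorSeq_sub_le x i pq.1 pq.2).trans ?_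
    rw [Fintype.sum_prod_type]
    simp only [Finset.sum_add_distrib, Finset.sum_const, Finset.card_univ, Fintype.card_fin,
      nsmul_eq_mul, ← Finset.mul_sum]
    linarith
  have h2 := two_mul_sum_sq_sub_lt_le (indicatorSeq x i)
  have h3 : (t : ℝ) * empiricalProb x i = ∑ s, indicatorSeq x i s := by
    unfold empiricalProb
    field_simp
  rw [sampleVariance, h3, one_div_mul_eq_div, div_le_div_iff₀ (by nlinarith) (by linarith)]
  have h4 : (0 : ℝ) ≤ t - 1 := by linarith
  nlinarith

lemma confidenceWidth_le {k t : ℕ} (ht : 2 ≤ t) {δ : ℝ} (x : Fin t → Fin k) (i : Fin k)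
    {q ε : ℝ} (hq : empiricalProb x i ≤ q)
    (hL : 0 ≤ Real.log (4 * k * (t : ℝ) ^ 2 / δ))
    (hε : Real.log (4 * k * (t : ℝ) ^ 2 / δ) ≤ ε * (t - 1)) :
    confidenceWidth δ x i ≤ Real.sqrt (2 * q * ε) + 7 / 3 * ε := by
  have ht' : (2 : ℝ) ≤ t := by exact_mod_cast ht
  unfold confidenceWidth
  set L := Real.log (4 * k * (t : ℝ) ^ 2 / δ)
  have hp := empiricalProb_nonneg x i
  have hV := sampleVariance_indicatorSeq_le ht x i
  have hLε : L / (t - 1) ≤ ε := (div_le_iff₀ (by linarith)).2 hε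
  have hL0 : 0 ≤ L / (t - 1) := div_nonneg hL (by linarith)
  refine add_le_add (Real.sqrt_le_sqrt ?_) ?_
  · calc 2 * sampleVariance (indicatorSeq x i) * L / t
        ≤ 2 * (t * empiricalProb x i / (t - 1)) * L / t := by gcongr
      _ = 2 * empiricalProb x i * (L / (t - 1)) := by
        have : (t : ℝ) - 1 ≠ 0 := by linarith
        field_simp
      _ ≤ 2 * q * ε := by
        have : 0 ≤ q := hp.trans hq
        gcongr
  · calc 7 * L / (3 * ((t : ℝ) - 1)) = 7 / 3 * (L / (t - 1)) := by
          rw [mul_div_mul_comm]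
      _ ≤ 7 / 3 * ε := by gcongr

/-- If the empirical frequencies are accurate up to a quarter of the gap, then the mode is
separated as soon as `t - 1` exceeds `65 p₁ / (p₁ - p₂)²` times the logarithmic factor. -/
lemma separated_of_accurate {k t : ℕ} (ht : 2 ≤ t) {δ : ℝ} (x : Fin t → Fin k) (i : Fin k)
    {p₁ p₂ : ℝ} (hp₂ : 0 ≤ p₂) (hgap : p₂ < p₁)
    (hL : 0 ≤ Real.log (4 * k * (t : ℝ) ^ 2 / δ))
    (hε : 65 * (p₁ / (p₁ - p₂) ^ 2) * Real.log (4 * k * (t : ℝ) ^ 2 / δ) ≤ t - 1)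
    (hlow : p₁ - (p₁ - p₂) / 4 ≤ empiricalProb x i)
    (hup : empiricalProb x i ≤ p₁ + (p₁ - p₂) / 4)
    (hother : ∀ j, j ≠ i → empiricalProb x j ≤ p₂ + (p₁ - p₂) / 4) :
    Separated δ x i := by
  refine ⟨ht, fun j hj => ?_⟩
  have hD : 0 < p₁ - p₂ := by linarith
  have hp₁ : 0 < p₁ := by linarith
  set L := Real.log (4 * k * (t : ℝ) ^ 2 / δ)
  have hε' : L ≤ (p₁ - p₂) ^ 2 / (65 * p₁) * (t - 1) := by
    calc L = (p₁ - p₂) ^ 2 / (65 * p₁) * (65 * (p₁ / (p₁ - p₂) ^ 2) * L) := by field_simp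
      _ ≤ _ := by gcongr
  -- The caps on the frequencies use `D ≤ p₁`: `p₁ + D / 4 ≤ 5 p₁ / 4` and `p₂ + D / 4 ≤ p₁`.
  have hbi := confidenceWidth_le ht x i (q := 5 / 4 * p₁) (by linarith) hL hε'
  have hbj := confidenceWidth_le ht x j (q := p₁) (by linarith [hother j hj]) hL hε'
  have hsi : Real.sqrt (2 * (5 / 4 * p₁) * ((p₁ - p₂) ^ 2 / (65 * p₁))) ≤ 0.2 * (p₁ - p₂) := by
    rw [Real.sqrt_le_left (by linarith)]
    have : 2 * (5 / 4 * p₁) * ((p₁ - p₂) ^ 2 / (65 * p₁)) = 1 / 26 * (p₁ - p₂) ^ 2 := by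
      field_simp; norm_num
    rw [this]; nlinarith [sq_nonneg (p₁ - p₂)]
  have hsj : Real.sqrt (2 * p₁ * ((p₁ - p₂) ^ 2 / (65 * p₁))) ≤ 0.18 * (p₁ - p₂) := by
    rw [Real.sqrt_le_left (by linarith)]
    have : 2 * p₁ * ((p₁ - p₂) ^ 2 / (65 * p₁)) = 2 / 65 * (p₁ - p₂) ^ 2 := by
      field_simp
    rw [this]; nlinarith [sq_nonneg (p₁ - p₂)]
  have hlin : (p₁ - p₂) ^ 2 / (65 * p₁) ≤ 1 / 65 * (p₁ - p₂) := by
    rw [div_le_iff₀ (by positivity)]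
    nlinarith
  -- The widths total at most `(0.2 + 0.18 + 2 · 7 / 195) D < D / 2`.
  have := hother j hj
  linarith

lemma numQueries_le {k : ℕ} {δ : ℝ} (x : ℕ → Fin k) {t : ℕ} {i : Fin k}
    (h : Separated δ (fun s : Fin t => x s) i) :
    (modeAlgorithm k δ).numQueries x ≤ t := by
  have ht := h.1
  refine iInf₂_le t ⟨by omega, ?_⟩
  have h' : ∃ i, Separated δ (fun s : Fin t => x s) i := ⟨i, h⟩
  exact ⟨h'.choose, dif_pos h'⟩

/-! ### The logarithmic inequality behind the query bound. -/

lemma four_mul_log_sq_le {y : ℝ} (hy : 197 ≤ y) : 4 * Real.log y ^ 2 ≤ y := by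
  -- With `w = y^(1/4) ≥ 3`, the claim becomes `8 log w ≤ w²`, and `log w ≤ w / e ≤ 3 w / 8` gives
  -- `8 log w ≤ 3 w ≤ w²`.
  set w := Real.sqrt (Real.sqrt y) with hw
  have hw4 : y = w ^ 4 := by
    rw [show w ^ 4 = (w ^ 2) ^ 2 by ring, hw, Real.sq_sqrt (Real.sqrt_nonneg _),
      Real.sq_sqrt (by linarith)]
  have hw3 : 3 ≤ w := by
    refine Real.le_sqrt_of_sq_le (Real.le_sqrt_of_sq_le ?_)
    linarith
  have hlog : Real.log w ≤ w / Real.exp 1 := by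
    have h := Real.log_le_sub_one_of_pos (x := w / Real.exp 1) (by positivity)
    rw [Real.log_div (by positivity) (by positivity), Real.log_exp] at h
    linarith
  have hlog' : Real.log w ≤ 3 / 8 * w := by
    refine hlog.trans ?_
    rw [div_le_iff₀ (Real.exp_pos 1)]
    nlinarith [Real.exp_one_gt_d9]
  have hlog0 : 0 ≤ Real.log w := Real.log_nonneg (by linarith)
  have h8 : 8 * Real.log w ≤ w ^ 2 := by nlinarith
  have hly : Real.log y = 4 * Real.log w := by rw [hw4, Real.log_pow]; norm_num
  rw [hly]
  calc 4 * (4 * Real.log w) ^ 2 = (8 * Real.log w) ^ 2 := by ring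
    _ ≤ (w ^ 2) ^ 2 := by gcongr
    _ = y := by rw [hw4]; ring

/-- At the time given by the query bound, the logarithmic factor is small compared to `t - 1`. -/
lemma log_factor_le {k t : ℕ} {δ a : ℝ} (hkδ : 1 ≤ k / δ) (ha : 1 ≤ a)
    (ht : t = ⌊592 / 3 * a * Real.log (592 / 3 * Real.sqrt (k / δ) * a)⌋₊) :
    2 ≤ t ∧ 0 ≤ Real.log (4 * k * (t : ℝ) ^ 2 / δ) ∧
      65 * a * Real.log (4 * k * (t : ℝ) ^ 2 / δ) ≤ t - 1 := by
  set s := Real.sqrt (k / δ) with hs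
  have hs1 : 1 ≤ s := Real.one_le_sqrt.2 hkδ
  have hs2 : s ^ 2 = k / δ := Real.sq_sqrt (by linarith)
  set y := 592 / 3 * s * a with hy
  have hy1 : 197 ≤ y := by nlinarith
  set l := Real.log y with hl
  have hl1 : 1 ≤ l := by
    rw [hl, Real.le_log_iff_exp_le (by linarith)]
    linarith [Real.exp_one_lt_d9]
  have hlsq : 4 * l ^ 2 ≤ y := four_mul_log_sq_le hy1
  have hal : 1 ≤ a * l := by nlinarith
  have hB : (t : ℝ) ≤ 592 / 3 * a * l := by
    rw [ht]; exact Nat.floor_le (by positivity)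
  have hB' : 592 / 3 * a * l - 1 < t := by
    rw [ht]; exact Nat.sub_one_lt_floor _
  have ht2 : (2 : ℝ) ≤ t := by nlinarith
  have hform : 4 * k * (t : ℝ) ^ 2 / δ = (2 * s * t) ^ 2 := by
    rw [mul_pow, mul_pow, hs2]; ring
  have hle : 4 * k * (t : ℝ) ^ 2 / δ ≤ y ^ 3 := by
    rw [hform]
    calc (2 * s * t) ^ 2 ≤ (2 * s * (592 / 3 * a * l)) ^ 2 := by gcongr
      _ = y ^ 2 * (4 * l ^ 2) := by rw [hy]; ring
      _ ≤ y ^ 2 * y := by gcongr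
      _ = y ^ 3 := by ring
  have hge : 1 ≤ 4 * k * (t : ℝ) ^ 2 / δ := by
    rw [hform]
    exact one_le_pow₀ (by nlinarith)
  have hL : Real.log (4 * k * (t : ℝ) ^ 2 / δ) ≤ 3 * l := by
    have := Real.log_le_log (by linarith) hle
    rwa [Real.log_pow, Nat.cast_ofNat] at this
  refine ⟨by exact_mod_cast ht2, Real.log_nonneg hge, ?_⟩
  -- `65 · 3 = 195 < 592 / 3`; the excess `7 / 3 · a l` absorbs the rounding and the `-1`.
  calc 65 * a * Real.log (4 * k * (t : ℝ) ^ 2 / δ) ≤ 65 * a * (3 * l) := by gcongr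
    _ ≤ t - 1 := by nlinarith

/-! ### Chernoff bounds for the empirical frequencies. -/

section Concentration

variable {Ω : Type*} [MeasurableSpace Ω] {μ : Measure Ω} [IsProbabilityMeasure μ]
  {k : ℕ} {P : PMF (Fin k)} {X : ℕ → Ω → Fin k}

/-- From `1 + u ≤ exp u` with `u = p (exp c - 1)`, and `exp c - 1 ≤ c + c²` on `[-1, 1]`; allowing
negative `c` serves the lower tail. -/
lemma mgf_indicator_le (i : Fin k) {Y : Ω → Fin k} (hY : Measurable Y)
    (hlaw : μ.map Y = P.toMeasure) {c : ℝ} (hc : |c| ≤ 1) :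
    mgf (fun ω => if Y ω = i then (1 : ℝ) else 0) μ c ≤
      Real.exp ((P i).toReal * (c + c ^ 2)) := by
  have hset : MeasurableSet (Y ⁻¹' {i}) := hY (measurableSet_singleton i)
  have hprob : μ.real (Y ⁻¹' {i}) = (P i).toReal := by
    rw [measureReal_def, ← Measure.map_apply hY (measurableSet_singleton i), hlaw,
      PMF.toMeasure_apply_singleton _ _ (measurableSet_singleton i)]
  have hfun : (fun ω => Real.exp (c * if Y ω = i then (1 : ℝ) else 0)) =
      fun ω => 1 + (Y ⁻¹' {i}).indicator (fun _ => Real.exp c - 1) ω := by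
    funext ω
    by_cases h : Y ω = i <;> simp [h]
  have hmgf : mgf (fun ω => if Y ω = i then (1 : ℝ) else 0) μ c =
      1 + (P i).toReal * (Real.exp c - 1) := by
    rw [mgf, hfun, integral_add (integrable_const _) ((integrable_const _).indicator hset),
      integral_indicator_const _ hset, hprob]
    simp
  have hexp : Real.exp c - 1 ≤ c + c ^ 2 := by
    have := (abs_le.1 (Real.abs_exp_sub_one_sub_id_le hc)).2
    linarith
  rw [hmgf]
  calc 1 + (P i).toReal * (Real.exp c - 1) ≤ (P i).toReal * (c + c ^ 2) + 1 := by
        rw [add_comm]; gcongr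
    _ ≤ _ := Real.add_one_le_exp _

lemma mgf_sum_indicatorSeq_le (hX : ∀ n, Measurable (X n)) (hindep : iIndepFun X μ)
    (hlaw : ∀ n, μ.map (X n) = P.toMeasure) (t : ℕ) (i : Fin k) {c : ℝ} (hc : |c| ≤ 1) :
    mgf (fun ω => ∑ s : Fin t, indicatorSeq (fun s : Fin t => X s ω) i s) μ c ≤
      Real.exp (t * ((P i).toReal * (c + c ^ 2))) := by
  have hmeas : Measurable fun j : Fin k => if j = i then (1 : ℝ) else 0 := measurable_of_finite _
  have hind : iIndepFun (fun (s : Fin t) ω => if X s ω = i then (1 : ℝ) else 0) μ :=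
    (hindep.precomp Fin.val_injective).comp (fun _ j => if j = i then (1 : ℝ) else 0)
      fun _ => hmeas
  have hsum := hind.mgf_sum (t := c) (fun s => hmeas.comp (hX s)) Finset.univ
  have hfun : (fun ω => ∑ s : Fin t, indicatorSeq (fun s : Fin t => X s ω) i s) =
      ∑ s : Fin t, fun ω => if X s ω = i then (1 : ℝ) else 0 := by
    funext ω
    simp [indicatorSeq]
  rw [hfun, hsum]
  refine (Finset.prod_le_prod (s := Finset.univ) (fun (s : Fin t) _ => mgf_nonneg)
    fun (s : Fin t) _ => mgf_indicator_le i (hX s) (hlaw s) hc).trans_eq ?_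
  rw [Finset.prod_const, Finset.card_univ, Fintype.card_fin, Real.exp_nat_mul]

lemma integrable_exp_sum_indicatorSeq (hX : ∀ n, Measurable (X n)) (t : ℕ) (i : Fin k) (c : ℝ) :
    Integrable
      (fun ω => Real.exp (c * ∑ s : Fin t, indicatorSeq (fun s : Fin t => X s ω) i s)) μ := by
  have hcomp : Measurable fun ω => fun s : Fin t => X s ω := measurable_pi_lambda _ fun s => hX s
  refine Integrable.of_finite.comp_measurable
    (g := fun x : Fin t → Fin k => Real.exp (c * ∑ s : Fin t, indicatorSeq x i s)) hcomp

lemma measureReal_empiricalProb_ge_le (hX : ∀ n, Measurable (X n)) (hindep : iIndepFun X μ)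
    (hlaw : ∀ n, μ.map (X n) = P.toMeasure) {t : ℕ} (ht : 0 < t) (i : Fin k) {c r : ℝ}
    (hc0 : 0 ≤ c) (hc : c ≤ 1) :
    μ.real {ω | (P i).toReal + r ≤ empiricalProb (fun s : Fin t => X s ω) i} ≤
      Real.exp (-(t * (c * r - (P i).toReal * c ^ 2))) := by
  have ht' : (0 : ℝ) < t := by exact_mod_cast ht
  have h := measure_ge_le_exp_mul_mgf (μ := μ) (t := c) (t * ((P i).toReal + r)) hc0
    (integrable_exp_sum_indicatorSeq hX t i c)
  have hset : {ω | (P i).toReal + r ≤ empiricalProb (fun s : Fin t => X s ω) i} =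
      {ω | t * ((P i).toReal + r) ≤ ∑ s : Fin t, indicatorSeq (fun s : Fin t => X s ω) i s} := by
    ext ω
    simp only [Set.mem_ofPred_eq, empiricalProb]
    rw [le_div_iff₀ ht', mul_comm]
  rw [hset]
  refine h.trans ((mul_le_mul_of_nonneg_left (mgf_sum_indicatorSeq_le hX hindep hlaw t i
    (abs_le.2 ⟨by linarith, hc⟩)) (Real.exp_nonneg _)).trans_eq ?_)
  rw [← Real.exp_add]
  congr 1
  ring

lemma measureReal_empiricalProb_le_le (hX : ∀ n, Measurable (X n)) (hindep : iIndepFun X μ)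
    (hlaw : ∀ n, μ.map (X n) = P.toMeasure) {t : ℕ} (ht : 0 < t) (i : Fin k) {c r : ℝ}
    (hc0 : 0 ≤ c) (hc : c ≤ 1) :
    μ.real {ω | empiricalProb (fun s : Fin t => X s ω) i ≤ (P i).toReal - r} ≤
      Real.exp (-(t * (c * r - (P i).toReal * c ^ 2))) := by
  have ht' : (0 : ℝ) < t := by exact_mod_cast ht
  have h := measure_le_le_exp_mul_mgf (μ := μ) (t := -c) (t * ((P i).toReal - r))
    (by linarith) (integrable_exp_sum_indicatorSeq hX t i (-c))
  have hset : {ω | empiricalProb (fun s : Fin t => X s ω) i ≤ (P i).toReal - r} =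
      {ω | ∑ s : Fin t, indicatorSeq (fun s : Fin t => X s ω) i s ≤ t * ((P i).toReal - r)} := by
    ext ω
    simp only [Set.mem_ofPred_eq, empiricalProb]
    rw [div_le_iff₀ ht', mul_comm]
  rw [hset]
  refine h.trans ((mul_le_mul_of_nonneg_left (mgf_sum_indicatorSeq_le hX hindep hlaw t i
    (abs_le.2 ⟨by linarith, by linarith⟩)) (Real.exp_nonneg _)).trans_eq ?_)
  rw [← Real.exp_add]
  congr 1
  ring

end Concentration

end ModeEstimation

open ModeEstimation

theorem theorem2 {Ω : Type*} [MeasurableSpace Ω] (μ : Measure Ω) [IsProbabilityMeasure μ]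
    (k : ℕ) (hk : 2 ≤ k) (P : PMF (Fin k)) (p : Fin k → ℝ) (hp : ∀ i, p i = (P i).toReal)
    (p₁ p₂ : ℝ) (hp₁ : p₁ = p ⟨0, by omega⟩) (hp₂ : p₂ = p ⟨1, by omega⟩)
    (hgap : p₂ < p₁) (hanti : Antitone p)
    (X : ℕ → Ω → Fin k) (hX : ∀ n, Measurable (X n)) (hindep : iIndepFun X μ)
    (hlaw : ∀ n, μ.map (X n) = P.toMeasure)
    (δ : ℝ) (hδ : 0 < δ) :
    1 - δ ≤ μ.real {ω | ∃ n : ℕ,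
      (ModeEstimation.modeAlgorithm k δ).numQueries (fun t => X t ω) = n ∧
      (n : ℝ) ≤ 592 / 3 * (p₁ / (p₁ - p₂) ^ 2) *
        Real.log (592 / 3 * Real.sqrt (k / δ) * (p₁ / (p₁ - p₂) ^ 2))} := by
  rcases le_or_gt 1 δ with hδ1 | hδ1
  · exact (sub_nonpos.2 hδ1).trans measureReal_nonneg
  have hp₂0 : 0 ≤ p₂ := by rw [hp₂, hp]; exact ENNReal.toReal_nonneg
  have hD : 0 < p₁ - p₂ := by linarith
  have hp₁0 : 0 < p₁ := by linarith
  have hp₁1 : p₁ ≤ 1 := by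
    rw [hp₁, hp]
    exact ENNReal.toReal_le_of_le_ofReal zero_le_one (by simpa using P.coe_le_one _)
  have hk2 : (2 : ℝ) ≤ k := by exact_mod_cast hk
  have hkδ : 1 ≤ k / δ := by rw [le_div_iff₀ hδ]; linarith
  have ha : 1 ≤ p₁ / (p₁ - p₂) ^ 2 := by rw [le_div_iff₀ (by positivity)]; nlinarith
  set B := 592 / 3 * (p₁ / (p₁ - p₂) ^ 2) *
        Real.log (592 / 3 * Real.sqrt (k / δ) * (p₁ / (p₁ - p₂) ^ 2)) with hB
  obtain ⟨t, ht⟩ : ∃ t, t = ⌊B⌋₊ := ⟨_, rfl⟩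
  obtain ⟨ht2, hL0, hL⟩ := log_factor_le hkδ ha ht
  set L := Real.log (4 * k * (t : ℝ) ^ 2 / δ) with hLdef
  have ht' : (2 : ℝ) ≤ t := by exact_mod_cast ht2
  have htB : (t : ℝ) ≤ B := by
    have h0 : 0 ≤ B := by
      by_contra h
      rw [Nat.floor_of_nonpos (by linarith)] at ht
      omega
    rw [ht]; exact Nat.floor_le h0
  let i₀ : Fin k := ⟨0, by omega⟩
  have hi₀ : (P i₀).toReal = p₁ := by rw [hp₁, hp]
  have hpi : ∀ i, (P i).toReal ≤ p₁ := fun i => by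
    rw [hp₁, ← hp]; exact hanti (Fin.mk_le_of_le_val (Nat.zero_le _))
  have hpj : ∀ j, j ≠ i₀ → (P j).toReal ≤ p₂ := fun j hj => by
    rw [hp₂, ← hp]
    refine hanti (Fin.mk_le_of_le_val (Nat.one_le_iff_ne_zero.2 fun h => hj (Fin.ext h)))
  -- the common tail bound, with exponent parameter `(p₁ - p₂) / (8 p₁)`
  set c := (p₁ - p₂) / (8 * p₁) with hc
  have hc0 : 0 ≤ c := by positivity
  have hc1 : c ≤ 1 := by rw [hc, div_le_one (by positivity)]; linarith
  have htail : ∀ i, Real.exp (-(t * (c * ((p₁ - p₂) / 4) - (P i).toReal * c ^ 2))) ≤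
      δ / (4 * k) := fun i => by
    -- This `c` maximises `c D / 4 - p₁ c²`, with value `D² / (64 p₁)`.
    have h1 : (p₁ - p₂) ^ 2 / (64 * p₁) ≤ c * ((p₁ - p₂) / 4) - (P i).toReal * c ^ 2 := by
      calc (p₁ - p₂) ^ 2 / (64 * p₁) = c * ((p₁ - p₂) / 4) - p₁ * c ^ 2 := by
            rw [hc]; field_simp; ring
        _ ≤ _ := by gcongr; exact hpi i
    have h2 : L ≤ t * (c * ((p₁ - p₂) / 4) - (P i).toReal * c ^ 2) := by
      calc L ≤ 65 / 64 * L := by linarith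
        _ = (p₁ - p₂) ^ 2 / (64 * p₁) * (65 * (p₁ / (p₁ - p₂) ^ 2) * L) := by field_simp
        _ ≤ (p₁ - p₂) ^ 2 / (64 * p₁) * t := by gcongr; linarith
        _ = t * ((p₁ - p₂) ^ 2 / (64 * p₁)) := mul_comm _ _
        _ ≤ _ := by gcongr
    calc _ ≤ Real.exp (-L) := Real.exp_le_exp.2 (neg_le_neg h2)
      _ = δ / (4 * k * (t : ℝ) ^ 2) := by
        rw [Real.exp_neg, hLdef, Real.exp_log (by positivity), inv_div]
      _ ≤ δ / (4 * k) := by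
        refine div_le_div_of_nonneg_left hδ.le (by positivity) ?_
        exact le_mul_of_one_le_right (by positivity) (one_le_pow₀ (by linarith))
  let U : Fin k → Set Ω := fun i =>
    {ω | (P i).toReal + (p₁ - p₂) / 4 ≤ empiricalProb (fun s : Fin t => X s ω) i}
  let V : Set Ω := {ω | empiricalProb (fun s : Fin t => X s ω) i₀ ≤
    (P i₀).toReal - (p₁ - p₂) / 4}
  have hU : ∀ i, μ.real (U i) ≤ δ / (4 * k) := fun i =>
    (measureReal_empiricalProb_ge_le hX hindep hlaw (by omega) i hc0 hc1).trans (htail i)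
  have hV : μ.real V ≤ δ / (4 * k) :=
    (measureReal_empiricalProb_le_le hX hindep hlaw (by omega) i₀ hc0 hc1).trans (htail i₀)
  -- There are `k + 1` bad events, each of probability at most `δ / (4 k)`.
  have hbad : μ.real ((⋃ i, U i) ∪ V) ≤ δ := by
    calc μ.real ((⋃ i, U i) ∪ V) ≤ μ.real (⋃ i, U i) + μ.real V := measureReal_union_le _ _
      _ ≤ ∑ i, μ.real (U i) + μ.real V := by gcongr; exact measureReal_iUnion_fintype_le _
      _ ≤ ∑ _i : Fin k, δ / (4 * k) + δ / (4 * k) := by gcongr with i; exact hU i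
      _ = δ / 4 + δ / (4 * k) := by
        rw [Finset.sum_const, Finset.card_univ, Fintype.card_fin, nsmul_eq_mul]
        field_simp
      _ ≤ δ / 4 + δ / 4 := by
        gcongr
        linarith
      _ ≤ δ := by linarith
  have hone : 1 ≤ μ.real (((⋃ i, U i) ∪ V)ᶜ) + μ.real ((⋃ i, U i) ∪ V) := by
    have := measureReal_union_le (μ := μ) (((⋃ i, U i) ∪ V)ᶜ) ((⋃ i, U i) ∪ V)
    rwa [Set.compl_union_self, probReal_univ] at this
  refine (show 1 - δ ≤ μ.real (((⋃ i, U i) ∪ V)ᶜ) by linarith).trans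
    (measureReal_mono fun ω hω => ?_)
  simp only [Set.compl_union, Set.mem_inter_iff, Set.mem_compl_iff, Set.mem_iUnion, not_exists,
    U, V, Set.mem_ofPred_eq, not_le] at hω
  obtain ⟨hωU, hωV⟩ := hω
  have hsep : Separated δ (fun s : Fin t => X s ω) i₀ := by
    refine separated_of_accurate ht2 _ i₀ hp₂0 hgap hL0 hL ?_ ?_ fun j hj => ?_
    · linarith
    · linarith [hωU i₀]
    · linarith [hωU j, hpj j hj]
  have hle := numQueries_le (fun n => X n ω) hsep
  obtain ⟨n, hn⟩ := ENat.ne_top_iff_exists.1 (ne_top_of_le_ne_top (ENat.natCast_ne_top t) hle)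
  refine ⟨n, hn.symm, ?_⟩
  rw [← hn, Nat.cast_le] at hle
  exact (Nat.cast_le.2 hle).trans htB
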